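/- **Setting.** Let $S^d$ be the unit sphere in $\mathbb{R}^{d+1}$; a $k$-dimensional subspace of $S^d$ is the intersection of $S^d$ with a $(k+1)$-dimensional linear subspace, and a hyperplane is a $(d-1)$-dimensional subspace. Let $\mathscr{A}$ be a finite collection of $(d-2)$-dimensional subspaces of $S^d$ (a codim-$2$-arrangement); its union is denoted by $\mathscr{A}$ as well. An extension of $\mathscr{A}$ is a finite collection $E$ of subspaces, each a hyperplane or an element of $\mathscr{A}$, such that every element of $\mathscr{A}$ is contained in some hyperplane belonging to $E$. For $S\subseteq E$ and $x\in S^d$, the stratum of $x$ and $S$ is the set of points that can be joined to $x$ by a curve that lies in all elements of $S$ and meets no element of $E\setminus S$. The extension is fine if the nonempty strata are the open cells of a regular CW structure on $S^d$; then $\mathbf{s}$ denotes this regular CW complex, a combinatorial stratification of $S^d$ induced by $\mathscr{A}$. Its faces are the closures of the strata, and the dimension of a face is that of its spherical span. The dual face $\sigma^*$ of a face $\sigma$ of $\mathbf{s}$ is the union of those simplices of the order complex of the face poset of $\mathbf{s}$ that correspond to chains with minimal element $\sigma$. The dual faces form the dual block complex $\mathbf{s}^*$. For $M\subseteq S^d$,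 $\mathrm{R}(\mathbf{s},M)$ is the maximal subcomplex of $\mathbf{s}$ all of whose faces are contained in $M$; for a subcomplex $C$ of $\mathbf{s}^*$, $\mathrm{R}^*(C,M)$ is the minimal subcomplex of $C$ containing all faces of $C$ that are dual to faces of $\mathbf{s}$ intersecting $M$. The complement complex is $\mathscr{K}:=\mathrm{R}^*(\mathbf{s}^*,S^d\setminus\mathscr{A})$. A Morse matching $\Phi$ on $\mathbf{s}$ is a collection of pairs $(\sigma,\Sigma)$ of faces, $\sigma$ a codimension-one face of $\Sigma$, such that no face lies in two different pairs and there is no closed gradient path, i.e. no sequence $(\sigma_0,\Sigma_0),\dots,(\sigma_k,\Sigma_k)$ in $\Phi$ with $k\ge 1$ and $\sigma_0=\sigma_k$ such that $\sigma_{j+1}\ne\sigma_j$ and $\sigma_{j+1}$ is a codimension-one face of $\Sigma_j$ for all $j<k$. Critical faces are the faces that lie in no pair. A face of a subcomplex $D$ of $\mathbf{s}$ is outwardly matched with respect to $(\mathbf{s},D)$ if it is matched with a face not in $D$. The dual matching is $\Phi^*=\{(\Sigma^*,\sigma^*):(\sigma,\Sigma)\in\Phi\}$, and for a subcomplex $D$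 of $\mathbf{s}^*$, $\Phi^*_D$ is the matching on $D$ consisting of all pairs of $\Phi^*$ with both faces in $D$; $\Phi^*_{\mathscr{K}}$ is the complement matching induced by $\Phi$. **Theorem.** Let $\mathscr{A}$ be a codim-$2$-arrangement in $S^d$, let $\mathbf{s}$ be a combinatorial stratification of $S^d$ induced by $\mathscr{A}$, let $\mathscr{K}$ be the complement complex, and let $\Phi$ be a Morse matching on $\mathbf{s}$. Then for every $i\ge 0$ the critical $i$-faces of $\Phi^*_{\mathscr{K}}$ are in one-to-one correspondence with the union of - the critical $(d-i)$-faces of $\Phi$ that are not faces of $\mathrm{R}(\mathbf{s},\mathscr{A})$, and - the outwardly matched $(d-i-1)$-faces of $\Phi$ with respect to the pair $(\mathbf{s},\mathrm{R}(\mathbf{s},\mathscr{A}))$. If, furthermore, $M$ is an open subset of $S^d$ such that all noncritical faces of $\Phi$ intersect $M$, then for every $i\ge 0$ the critical $i$-faces of $\Phi^*_{\mathrm{R}^*(\mathscr{K},M)}$ are in one-to-one correspondence with the union of - the critical $(d-i)$-faces of $\Phi$ that are not faces of $\mathrm{R}(\mathbf{s},\mathscr{A})$ and that intersect $M$, and -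 the outwardly matched $(d-i-1)$-faces of $\Phi$ with respect to the pair $(\mathbf{s},\mathrm{R}(\mathbf{s},\mathscr{A}))$. -/

import Mathlib

namespace MorseDuality

/-! ### Matchings on the faces of a cell complex

A complex is given by its set `C` of (nonempty, closed) faces inside an ambient partial order `P`
of point sets ordered by inclusion, together with the dimension function `dim` of faces. -/

section Matchings

variable {P : Type*} [PartialOrder P]

/-- `σ` is a codimension-one face of `τ`. -/
def IsCodimOneFace (dim : P → ℕ) (σ τ : P) : Prop :=
  σ ≤ τ ∧ dim τ = dim σ + 1

/-- A discrete vector field on `C`: a collection of pairs `(σ, τ)` of faces of `C` with `σ` a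
codimension-one face of `τ`, such that no face belongs to two different pairs. -/
structure IsDiscreteVectorField (C : Set P) (dim : P → ℕ) (Φ : Set (P × P)) : Prop where
  mem : ∀ p ∈ Φ, p.1 ∈ C ∧ p.2 ∈ C
  codimOne : ∀ p ∈ Φ, IsCodimOneFace dim p.1 p.2
  unique : ∀ p ∈ Φ, ∀ q ∈ Φ, ∀ σ : P, (σ = p.1 ∨ σ = p.2) → (σ = q.1 ∨ σ = q.2) → p = q

/-- `(σ 0, τ 0), …, (σ k, τ k)` with `1 ≤ k` is a gradient path of `Φ`. -/
structure IsGradientPath (dim : P → ℕ) (Φ : Set (P × P)) (k : ℕ) (σ τ : ℕ → P) : Prop where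
  one_le : 1 ≤ k
  mem : ∀ j ≤ k, (σ j, τ j) ∈ Φ
  ne : ∀ j < k, σ (j + 1) ≠ σ j
  codimOne : ∀ j < k, IsCodimOneFace dim (σ (j + 1)) (τ j)

/-- A Morse matching: a discrete vector field without closed gradient paths. -/
structure IsMorseMatching (C : Set P) (dim : P → ℕ) (Φ : Set (P × P)) : Prop where
  vectorField : IsDiscreteVectorField C dim Φ
  noClosedPath : ∀ (k : ℕ) (σ τ : ℕ → P), IsGradientPath dim Φ k σ τ → σ 0 ≠ σ k

/-- The critical faces: the faces of `C` that are in none of the matching pairs. -/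
def criticalFaces (C : Set P) (Φ : Set (P × P)) : Set P :=
  {σ | σ ∈ C ∧ ∀ p ∈ Φ, σ ≠ p.1 ∧ σ ≠ p.2}

/-- The critical faces of dimension `i`. -/
def criticalFacesOfDim (C : Set P) (dim : P → ℕ) (Φ : Set (P × P)) (i : ℕ) : Set P :=
  {σ | σ ∈ criticalFaces C Φ ∧ dim σ = i}

/-- The restriction of a matching to a subcomplex `D`: all pairs involving two faces of `D`. -/
def restrictMatching (Φ : Set (P × P)) (D : Set P) : Set (P × P) :=
  {p | p ∈ Φ ∧ p.1 ∈ D ∧ p.2 ∈ D}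

/-- The outwardly matched faces of the subcomplex `D`: the faces of `D` that are matched by `Φ`
with a face not belonging to `D`. -/
def outwardlyMatched (D : Set P) (Φ : Set (P × P)) : Set P :=
  {σ | σ ∈ D ∧ ∃ τ, τ ∉ D ∧ ((σ, τ) ∈ Φ ∨ (τ, σ) ∈ Φ)}

/-- `D` is a subcomplex of `C`: a set of faces of `C` containing all faces (in `C`) of its
members. -/
def IsSubcomplex (C D : Set P) : Prop :=
  D ⊆ C ∧ ∀ σ ∈ C, ∀ τ ∈ D, σ ≤ τ → σ ∈ D

end Matchings

/-! ### Barycentric subdivision and the dual block complex -/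

section Dual

variable {P : Type*} [PartialOrder P]

/-- The order complex `sd C` of the face poset of `C`: its simplices are the nonempty finite
chains of faces. -/
def orderComplex (C : Set P) : PreAbstractSimplicialComplex P where
  faces := {c | c.Nonempty ∧ (c : Set P) ⊆ C ∧ IsChain (· ≤ ·) (c : Set P)}
  isRelLowerSet_faces := by
    rintro c ⟨hne, hC, hch⟩
    refine ⟨hne, fun b hb hbne => ⟨hbne, ?_, ?_⟩⟩
    · exact fun x hx => hC (hb hx)
    · exact hch.mono (fun x hx => hb hx)

/-- The dual face `σ*`: the union of the closed simplices of `sd C` that correspond to chains with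
minimal element `σ`, as a subcomplex of `sd C`. Dual faces are ordered by inclusion. -/
def dualFace (C : Set P) (σ : P) : PreAbstractSimplicialComplex P where
  faces := {c | c.Nonempty ∧ ∃ c' ∈ orderComplex C, c ⊆ c' ∧ IsLeast (c' : Set P) σ}
  isRelLowerSet_faces := by
    rintro c ⟨hne, c', hc', hcc', hl⟩
    exact ⟨hne, fun b hb hbne => ⟨hbne, c', hc', fun x hx => hcc' (hb hx), hl⟩⟩

/-- The dual block complex `C*`, as its set of faces. -/
def dualComplex (C : Set P) : Set (PreAbstractSimplicialComplex P) :=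
  dualFace C '' C

/-- The dimension of a block, i.e. of a (finite-dimensional, nonempty) simplicial complex: the
largest dimension of one of its simplices. -/
noncomputable def blockDim (K : PreAbstractSimplicialComplex P) : ℕ :=
  sSup ((fun c : Finset P => c.card - 1) '' K.faces)

/-- The dual matching `Φ* = {(τ*, σ*) : (σ, τ) ∈ Φ}`. -/
def dualMatching (C : Set P) (Φ : Set (P × P)) :
    Set (PreAbstractSimplicialComplex P × PreAbstractSimplicialComplex P) :=
  (fun p => (dualFace C p.2, dualFace C p.1)) '' Φ

end Dual

/-! ### Codim-2-arrangements in the sphere and their stratifications -/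

/-- The unit sphere `S^d` in `ℝ^(d+1)`. -/
abbrev Sph (d : ℕ) : Type := Metric.sphere (0 : EuclideanSpace ℝ (Fin (d + 1))) 1

/-- The ambient linear subspaces. A `k`-dimensional subspace of `S^d` is encoded by the
`(k+1)`-dimensional linear subspace of `ℝ^(d+1)` that cuts it out. -/
abbrev LinSub (d : ℕ) : Type := Submodule ℝ (EuclideanSpace ℝ (Fin (d + 1)))

/-- The subspace of `S^d` cut out by a linear subspace. -/
def trace {d : ℕ} (L : LinSub d) : Set (Sph d) :=
  {x | (x : EuclideanSpace ℝ (Fin (d + 1))) ∈ L}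

/-- Hyperplanes of `S^d`: subspaces of dimension `d - 1`. -/
def IsHyperplane {d : ℕ} (L : LinSub d) : Prop :=
  Module.finrank ℝ L + 1 = d + 1

/-- A codim-2-arrangement in `S^d`: a finite collection of `(d-2)`-dimensional subspaces. -/
def IsCodimTwoArrangement {d : ℕ} (A : Set (LinSub d)) : Prop :=
  A.Finite ∧ ∀ h ∈ A, Module.finrank ℝ h + 2 = d + 1

/-- The union of the elements of an arrangement. -/
def support {d : ℕ} (A : Set (LinSub d)) : Set (Sph d) :=
  ⋃ h ∈ A, trace h

/-- `E` is an extension of the arrangement `A`: a finite collection that consists of hyperplanes,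
among them one through every element of `A`, and possibly of elements of `A` itself (these have to
be added to `E` whenever the strata are supposed to subdivide the elements of `A`). -/
structure IsExtension {d : ℕ} (A E : Set (LinSub d)) : Prop where
  finite : E.Finite
  mem : ∀ L ∈ E, IsHyperplane L ∨ L ∈ A
  exists_hyperplane : ∀ h ∈ A, ∃ H ∈ E, IsHyperplane H ∧ h ≤ H

/-- The set of points that lie in all elements of `S` and in no element of `E \ S`. -/
def locus {d : ℕ} (E S : Set (LinSub d)) : Set (Sph d) :=
  {x | (∀ L ∈ S, x ∈ trace L) ∧ ∀ L ∈ E \ S, x ∉ trace L}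

/-- The nonempty strata: the sets of all points that can be joined to a point `x` by a curve that
lies in all elements of `S` and meets no element of `E \ S`. -/
def strata {d : ℕ} (E : Set (LinSub d)) : Set (Set (Sph d)) :=
  {T | T.Nonempty ∧ ∃ S ⊆ E, ∃ x : Sph d, T = pathComponentIn (locus E S) x}

/-- The extension `E` is fine: `S^d` has the structure of a regular CW complex (every
characteristic map is injective on the closed ball) whose open cells are the strata. -/
def IsFine {d : ℕ} (E : Set (LinSub d)) : Prop :=
  ∃ cw : Topology.CWComplex (Set.univ : Set (Sph d)),
    {T : Set (Sph d) | ∃ (n : ℕ) (e : cw.cell n), T = cw.map n e '' Metric.ball 0 1} = strata E ∧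
    ∀ (n : ℕ) (e : cw.cell n), Set.InjOn (cw.map n e) (Metric.closedBall 0 1)

/-- The faces of the stratification: the closures of the strata. -/
def stratFaces {d : ℕ} (E : Set (LinSub d)) : Set (Set (Sph d)) :=
  closure '' strata E

/-- The dimension of a nonempty convex subset of `S^d`, i.e. of its spherical span. -/
noncomputable def sphDim {d : ℕ} (σ : Set (Sph d)) : ℕ :=
  Module.finrank ℝ (Submodule.span ℝ
    ((fun x : Sph d => (x : EuclideanSpace ℝ (Fin (d + 1)))) '' σ)) - 1

/-- `R(C, M)`: the maximal subcomplex of `C` all of whose faces are contained in `M`. -/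
def restr {d : ℕ} (C : Set (Set (Sph d))) (M : Set (Sph d)) : Set (Set (Sph d)) :=
  ⋃₀ {D | IsSubcomplex C D ∧ ∀ σ ∈ D, σ ⊆ M}

/-- `R*(C, M)` for a subcomplex `C` of the dual block complex of `s`: the minimal subcomplex of `C`
containing all those faces of `C` that are dual to faces of `s` intersecting `M`. -/
def dualRestr {d : ℕ} (s : Set (Set (Sph d)))
    (C : Set (PreAbstractSimplicialComplex (Set (Sph d)))) (M : Set (Sph d)) :
    Set (PreAbstractSimplicialComplex (Set (Sph d))) :=
  ⋂₀ {D | IsSubcomplex C D ∧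
    ∀ σ ∈ s, (σ ∩ M).Nonempty → dualFace s σ ∈ C → dualFace s σ ∈ D}

/-- The complement complex `K(A, s) = R*(s*, S^d \ A)`. -/
def complementComplex {d : ℕ} (A : Set (LinSub d)) (s : Set (Set (Sph d))) :
    Set (PreAbstractSimplicialComplex (Set (Sph d))) :=
  dualRestr s (dualComplex s) (support A)ᶜ

end MorseDuality

open MorseDuality

/-! Duality reverses inclusions, so the dual block complex restricted to the faces outside `R(s, A)`
corresponds to an upward closed set of faces of `s`. Discarding the faces of `R(s, A)` breaks up
exactly the pairs `(σ, τ)` with `σ` outwardly matched, and each of them leaves behind the critical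
face `τ*`. Faces that do not meet `M` are critical, so discarding them breaks up no further pair.

The dimension count `dim σ* + dim σ = d` says that every face lies in a chain reaching dimension
`d`. For a stratum whose span is a proper flat `V`, modularity of the lattice of subspaces provides
a vector `w` such that the elements of the extension through `V` and `w` intersect in a flat
covering `V`, and pushing the stratum slightly in the direction `w` shows that it lies in the
closure of a stratum spanning that flat. -/

namespace MorseDuality

section Matchings

variable {P : Type*} [PartialOrder P] {C D U : Set P} {dim : P → ℕ} {Φ : Set (P × P)}

/-- The pairs along which the matching `Φ` leads out of the subcomplex `D`. -/
def outwardPairs (D : Set P) (Φ : Set (P × P)) : Set (P × P) :=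
  {p ∈ Φ | p.1 ∈ D ∧ p.2 ∉ D}

theorem IsDiscreteVectorField.injOn_fst (hΦ : IsDiscreteVectorField C dim Φ) :
    Set.InjOn Prod.fst Φ :=
  fun p hp q hq h => hΦ.unique p hp q hq p.1 (.inl rfl) (.inl h)

theorem IsDiscreteVectorField.injOn_snd (hΦ : IsDiscreteVectorField C dim Φ) :
    Set.InjOn Prod.snd Φ :=
  fun p hp q hq h => hΦ.unique p hp q hq p.2 (.inr rfl) (.inr h)

theorem outwardlyMatched_eq_image_fst (hΦ : IsDiscreteVectorField C dim Φ)
    (hD : IsSubcomplex C D) : outwardlyMatched D Φ = Prod.fst '' outwardPairs D Φ := by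
  ext σ
  constructor
  · rintro ⟨hσ, τ, hτ, hστ | hτσ⟩
    · exact ⟨(σ, τ), ⟨hστ, hσ, hτ⟩, rfl⟩
    · exact (hτ (hD.2 τ (hΦ.mem _ hτσ).1 σ hσ (hΦ.codimOne _ hτσ).1)).elim
  · rintro ⟨⟨σ, τ⟩, ⟨hστ, hσ, hτ⟩, rfl⟩
    exact ⟨hσ, τ, hτ, .inl hστ⟩

theorem setOf_outwardlyMatched_dim_eq (hΦ : IsDiscreteVectorField C dim Φ)
    (hD : IsSubcomplex C D) (i d : ℕ) :
    {σ | σ ∈ outwardlyMatched D Φ ∧ dim σ + i + 1 = d} =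
      Prod.fst '' {p ∈ outwardPairs D Φ | dim p.2 + i = d} := by
  have hpair (p) (hp : p ∈ outwardPairs D Φ) : dim p.1 + i + 1 = dim p.2 + i := by
    rw [(hΦ.codimOne p hp.1).2]
    ring
  rw [outwardlyMatched_eq_image_fst hΦ hD]
  ext σ
  constructor
  · rintro ⟨⟨p, hp, rfl⟩, h⟩
    exact ⟨p, ⟨hp, (hpair p hp).symm.trans h⟩, rfl⟩
  · rintro ⟨p, ⟨hp, h⟩, rfl⟩
    exact ⟨⟨p, hp, rfl⟩, (hpair p hp).trans h⟩

theorem nonempty_union_image_snd_equiv_union_image_fst (hΦ : IsDiscreteVectorField C dim Φ)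
    {T : Set P} {Ψ : Set (P × P)} (hT : T ⊆ criticalFaces C Φ) (hΨ : Ψ ⊆ Φ) :
    Nonempty (↥(T ∪ Prod.snd '' Ψ) ≃ ↥(T ∪ Prod.fst '' Ψ)) := by
  classical
  have hsnd : Disjoint T (Prod.snd '' Ψ) := Set.disjoint_left.2 <| by
    rintro _ hσ ⟨p, hp, rfl⟩
    exact ((hT hσ).2 p (hΨ hp)).2 rfl
  have hfst : Disjoint T (Prod.fst '' Ψ) := Set.disjoint_left.2 <| by
    rintro _ hσ ⟨p, hp, rfl⟩
    exact ((hT hσ).2 p (hΨ hp)).1 rfl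
  have swap : ↥(Prod.snd '' Ψ) ≃ ↥(Prod.fst '' Ψ) :=
    (Equiv.Set.imageOfInjOn _ _ (hΦ.injOn_snd.mono hΨ)).symm.trans
      (Equiv.Set.imageOfInjOn _ _ (hΦ.injOn_fst.mono hΨ))
  exact ⟨(Equiv.Set.union hsnd).trans <|
    (Equiv.sumCongr (Equiv.refl _) swap).trans (Equiv.Set.union hfst).symm⟩

/-- Discarding all faces outside the upward closed set `U` breaks up the pairs that enter `U`. As
`D ∪ U` contains all matched faces, these are the pairs leading out of `D`, and their larger
members become critical. -/
theorem criticalFaces_restrictMatching (hΦ : IsDiscreteVectorField C dim Φ)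
    (hUD : Disjoint U D) (hU : ∀ σ ∈ C, ∀ τ ∈ C, σ ≤ τ → σ ∈ U → τ ∈ U)
    (hDU : ∀ σ ∈ C, σ ∉ criticalFaces C Φ → σ ∉ D → σ ∈ U) :
    criticalFaces (C ∩ U) (restrictMatching Φ (C ∩ U)) =
      criticalFaces C Φ ∩ U ∪ Prod.snd '' outwardPairs D Φ := by
  ext σ
  constructor
  · rintro ⟨⟨hσC, hσU⟩, hcrit⟩
    by_cases hσ : σ ∈ criticalFaces C Φ
    · exact .inl ⟨hσ, hσU⟩
    obtain ⟨p, hp, hσp⟩ : ∃ p ∈ Φ, σ = p.1 ∨ σ = p.2 := by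
      by_contra! h
      exact hσ ⟨hσC, h⟩
    obtain ⟨hp₁, hp₂⟩ := hΦ.mem p hp
    rcases hσp with rfl | rfl
    · have hp₂U := hU _ hp₁ _ hp₂ (hΦ.codimOne p hp).1 hσU
      exact ((hcrit p ⟨hp, ⟨hp₁, hσU⟩, hp₂, hp₂U⟩).1 rfl).elim
    · have hp₁U : p.1 ∉ U := fun h => (hcrit p ⟨hp, ⟨hp₁, h⟩, hp₂, hσU⟩).2 rfl
      have hp₁D : p.1 ∈ D := by
        by_contra h
        exact hp₁U (hDU _ hp₁ (fun hc => (hc.2 p hp).1 rfl) h)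
      exact .inr ⟨p, ⟨hp, hp₁D, hUD.notMem_of_mem_left hσU⟩, rfl⟩
  · rintro (⟨⟨hσC, hcrit⟩, hσU⟩ | ⟨p, ⟨hp, hp₁, hp₂⟩, rfl⟩)
    · exact ⟨⟨hσC, hσU⟩, fun p hp => hcrit p hp.1⟩
    · have hp₂C := (hΦ.mem p hp).2
      refine ⟨⟨hp₂C, hDU _ hp₂C (fun hc => (hc.2 p hp).2 rfl) hp₂⟩, fun q hq => ?_⟩
      rw [← not_or]
      intro h
      obtain rfl := hΦ.unique p hp q hq.1 p.2 (.inr rfl) h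
      exact hUD.notMem_of_mem_left hq.2.1.2 hp₁

end Matchings

section OrderComplex

variable {P : Type*} [PartialOrder P] {C : Set P} {σ τ : P} {c : Finset P}

theorem singleton_mem_orderComplex (hσ : σ ∈ C) : {σ} ∈ orderComplex C :=
  ⟨by simp, by simpa using hσ, by simp⟩

theorem insert_mem_orderComplex [DecidableEq P] (hσ : σ ∈ C) (hc : c ∈ orderComplex C)
    (hσc : ∀ ρ ∈ c, σ ≤ ρ) : insert σ c ∈ orderComplex C := by
  obtain ⟨-, hcC, hchain⟩ := hc
  refine ⟨c.insert_nonempty σ, ?_, ?_⟩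
  · rw [Finset.coe_insert]
    exact Set.insert_subset hσ hcC
  · rw [Finset.coe_insert]
    exact hchain.insert fun ρ hρ _ => .inl (hσc ρ hρ)

theorem isLeast_insert_of_forall_le [DecidableEq P] (hσc : ∀ ρ ∈ c, σ ≤ ρ) :
    IsLeast (↑(insert σ c) : Set P) σ :=
  ⟨by simp, by simpa [mem_lowerBounds] using hσc⟩

theorem dualFace_le_dualFace_iff (hσ : σ ∈ C) (hτ : τ ∈ C) :
    dualFace C τ ≤ dualFace C σ ↔ σ ≤ τ := by
  classical
  constructor
  · intro h
    have hmem : {τ} ∈ dualFace C τ :=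
      ⟨by simp, {τ}, singleton_mem_orderComplex hτ, subset_rfl, by simp⟩
    obtain ⟨-, c, -, hτc, hσc⟩ := h hmem
    exact hσc.2 (hτc (Finset.mem_singleton_self τ))
  · rintro h b ⟨hb, c, hc, hbc, hτc⟩
    have hσc : ∀ ρ ∈ c, σ ≤ ρ := fun ρ hρ => h.trans (hτc.2 hρ)
    exact ⟨hb, insert σ c, insert_mem_orderComplex hσ hc hσc,
      hbc.trans (Finset.subset_insert σ c), isLeast_insert_of_forall_le hσc⟩

theorem dualFace_injOn : Set.InjOn (dualFace C) C := fun _ hσ _ hτ h =>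
  le_antisymm ((dualFace_le_dualFace_iff hσ hτ).1 h.ge)
    ((dualFace_le_dualFace_iff hτ hσ).1 h.le)

section BlockDim

variable {dim : P → ℕ} {m : ℕ}

theorem card_add_le_of_mem_orderComplex (hdim : StrictMonoOn dim C) (hm : ∀ ρ ∈ C, dim ρ ≤ m)
    (hc : c ∈ orderComplex C) (hσ : IsLeast (c : Set P) σ) : c.card + dim σ ≤ m + 1 := by
  obtain ⟨-, hcC, hchain⟩ := hc
  have hmaps : Set.MapsTo dim c (Finset.Icc (dim σ) m) := fun ρ hρ =>
    Finset.mem_Icc.2 ⟨hdim.monotoneOn (hcC hσ.1) (hcC hρ) (hσ.2 hρ), hm ρ (hcC hρ)⟩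
  have hinj : Set.InjOn dim c := by
    intro ρ hρ ρ' hρ' h
    by_contra hne
    rcases hchain hρ hρ' hne with hlt | hlt
    · exact (hdim (hcC hρ) (hcC hρ') (hlt.lt_of_ne hne)).ne h
    · exact (hdim (hcC hρ') (hcC hρ) (hlt.lt_of_ne' hne)).ne' h
  have hcard := Finset.card_le_card_of_injOn dim hmaps hinj
  have hσm := hm σ (hcC hσ.1)
  rw [Nat.card_Icc] at hcard
  omega

theorem exists_mem_orderComplex_card_eq
    (hcover : ∀ ρ ∈ C, dim ρ < m → ∃ τ ∈ C, ρ < τ ∧ dim τ = dim ρ + 1) (n : ℕ) (hσ : σ ∈ C)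
    (hn : dim σ + n = m) : ∃ c ∈ orderComplex C, IsLeast (c : Set P) σ ∧ c.card = n + 1 := by
  classical
  induction n generalizing σ with
  | zero => exact ⟨{σ}, singleton_mem_orderComplex hσ, by simp, by simp⟩
  | succ n ih =>
    obtain ⟨τ, hτ, hστ, hdim⟩ := hcover σ hσ (by omega)
    obtain ⟨c, hc, hτc, hcard⟩ := ih hτ (by omega)
    have hσc : ∀ ρ ∈ c, σ < ρ := fun ρ hρ => hστ.trans_le (hτc.2 hρ)
    have hσc' : ∀ ρ ∈ c, σ ≤ ρ := fun ρ hρ => (hσc ρ hρ).le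
    refine ⟨insert σ c, insert_mem_orderComplex hσ hc hσc', isLeast_insert_of_forall_le hσc', ?_⟩
    rw [Finset.card_insert_of_notMem fun h => (hσc σ h).false, hcard]

theorem blockDim_dualFace_add (hdim : StrictMonoOn dim C) (hm : ∀ ρ ∈ C, dim ρ ≤ m)
    (hcover : ∀ ρ ∈ C, dim ρ < m → ∃ τ ∈ C, ρ < τ ∧ dim τ = dim ρ + 1) (hσ : σ ∈ C) :
    blockDim (dualFace C σ) + dim σ = m := by
  have hσm := hm σ hσ
  have hgreatest : IsGreatest ((fun c : Finset P => c.card - 1) '' (dualFace C σ).faces)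
      (m - dim σ) := by
    constructor
    · obtain ⟨c, hc, hσc, hcard⟩ :=
        exists_mem_orderComplex_card_eq hcover (m - dim σ) hσ (by omega)
      exact ⟨c, ⟨hc.1, c, hc, subset_rfl, hσc⟩, by simp [hcard]⟩
    · rintro _ ⟨b, ⟨-, c, hc, hbc, hσc⟩, rfl⟩
      have hcard := card_add_le_of_mem_orderComplex hdim hm hc hσc
      have hbcard := Finset.card_le_card hbc
      dsimp only
      omega
  rw [blockDim, hgreatest.csSup_eq]
  omega

end BlockDim

end OrderComplex

section DualMatching

variable {P : Type*} [PartialOrder P] {C D N U : Set P} {dim : P → ℕ} {d : ℕ} {Φ : Set (P × P)}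

theorem restrictMatching_dualMatching (hΦ : ∀ p ∈ Φ, p.1 ∈ C ∧ p.2 ∈ C) (hN : N ⊆ C) :
    restrictMatching (dualMatching C Φ) (dualFace C '' N) =
      dualMatching C (restrictMatching Φ N) := by
  ext q
  constructor
  · rintro ⟨⟨p, hp, rfl⟩, hp₂, hp₁⟩
    exact ⟨p, ⟨hp, (dualFace_injOn.mem_image_iff hN (hΦ p hp).1).1 hp₁,
      (dualFace_injOn.mem_image_iff hN (hΦ p hp).2).1 hp₂⟩, rfl⟩
  · rintro ⟨p, ⟨hp, hp₁, hp₂⟩, rfl⟩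
    exact ⟨⟨p, hp, rfl⟩, ⟨p.2, hp₂, rfl⟩, p.1, hp₁, rfl⟩

theorem criticalFaces_dualMatching (hΦ : ∀ p ∈ Φ, p.1 ∈ C ∧ p.2 ∈ C) (hN : N ⊆ C) :
    criticalFaces (dualFace C '' N) (dualMatching C Φ) = dualFace C '' criticalFaces N Φ := by
  ext K
  constructor
  · rintro ⟨⟨σ, hσ, rfl⟩, hcrit⟩
    exact ⟨σ, ⟨hσ, fun p hp => ⟨fun h => (hcrit _ ⟨p, hp, rfl⟩).2 (congrArg (dualFace C) h),
      fun h => (hcrit _ ⟨p, hp, rfl⟩).1 (congrArg (dualFace C) h)⟩⟩, rfl⟩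
  · rintro ⟨σ, ⟨hσ, hcrit⟩, rfl⟩
    refine ⟨⟨σ, hσ, rfl⟩, ?_⟩
    rintro _ ⟨p, hp, rfl⟩
    exact ⟨fun h => (hcrit p hp).2 (dualFace_injOn (hN hσ) (hΦ p hp).2 h),
      fun h => (hcrit p hp).1 (dualFace_injOn (hN hσ) (hΦ p hp).1 h)⟩

theorem criticalFacesOfDim_dualMatching
    (hdim : ∀ σ ∈ C, blockDim (dualFace C σ) + dim σ = d) (hΦ : ∀ p ∈ Φ, p.1 ∈ C ∧ p.2 ∈ C)
    (hN : N ⊆ C) (i : ℕ) :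
    criticalFacesOfDim (dualFace C '' N) blockDim
        (restrictMatching (dualMatching C Φ) (dualFace C '' N)) i =
      dualFace C '' {σ ∈ criticalFaces N (restrictMatching Φ N) | dim σ + i = d} := by
  rw [criticalFacesOfDim, restrictMatching_dualMatching hΦ hN,
    criticalFaces_dualMatching (fun p hp => hΦ p hp.1) hN]
  ext K
  constructor
  · rintro ⟨⟨σ, hσ, rfl⟩, rfl⟩
    exact ⟨σ, ⟨hσ, (add_comm _ _).trans (hdim σ (hN hσ.1))⟩, rfl⟩
  · rintro ⟨σ, ⟨hσ, hi⟩, rfl⟩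
    have hσd := hdim σ (hN hσ.1)
    exact ⟨⟨σ, hσ, rfl⟩, by omega⟩

theorem nonempty_criticalFacesOfDim_dualMatching_equiv
    (hdim : ∀ σ ∈ C, blockDim (dualFace C σ) + dim σ = d) (hΦ : IsDiscreteVectorField C dim Φ)
    (hD : IsSubcomplex C D) (hUD : Disjoint U D)
    (hU : ∀ σ ∈ C, ∀ τ ∈ C, σ ≤ τ → σ ∈ U → τ ∈ U)
    (hDU : ∀ σ ∈ C, σ ∉ criticalFaces C Φ → σ ∉ D → σ ∈ U) (i : ℕ) :
    Nonempty
      (↥(criticalFacesOfDim (dualFace C '' (C ∩ U)) blockDim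
          (restrictMatching (dualMatching C Φ) (dualFace C '' (C ∩ U))) i) ≃
        ↥({σ | σ ∈ criticalFaces C Φ ∧ dim σ + i = d ∧ σ ∈ U} ∪
          {σ | σ ∈ outwardlyMatched D Φ ∧ dim σ + i + 1 = d})) := by
  set crit := {σ | σ ∈ criticalFaces C Φ ∧ dim σ + i = d ∧ σ ∈ U} with hcrit
  set out := {p ∈ outwardPairs D Φ | dim p.2 + i = d} with hout
  have hsource : {σ ∈ criticalFaces (C ∩ U) (restrictMatching Φ (C ∩ U)) | dim σ + i = d} =
      crit ∪ Prod.snd '' out := by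
    rw [criticalFaces_restrictMatching hΦ hUD hU hDU]
    ext σ
    simp only [hcrit, hout]
    aesop
  have hC : crit ∪ Prod.snd '' out ⊆ C := hsource ▸ fun σ hσ => hσ.1.1.1
  rw [criticalFacesOfDim_dualMatching hdim hΦ.mem Set.inter_subset_left, hsource,
    setOf_outwardlyMatched_dim_eq hΦ hD]
  obtain ⟨e⟩ := nonempty_union_image_snd_equiv_union_image_fst hΦ (T := crit) (Ψ := out)
    (fun _ hσ => hσ.1) fun _ hp => hp.1.1
  exact ⟨(Equiv.Set.imageOfInjOn _ _ (dualFace_injOn.mono hC)).symm.trans e⟩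

end DualMatching

section Restriction

variable {d : ℕ} {s N : Set (Set (Sph d))}

theorem restr_eq (s : Set (Set (Sph d))) (X : Set (Sph d)) : restr s X = {σ ∈ s | σ ⊆ X} := by
  apply Set.Subset.antisymm
  · rintro σ ⟨D, ⟨hD, hDX⟩, hσ⟩
    exact ⟨hD.1 hσ, hDX σ hσ⟩
  · intro σ hσ
    exact ⟨{σ ∈ s | σ ⊆ X}, ⟨⟨fun _ hτ => hτ.1, fun _ hτ _ hρ hle => ⟨hτ, hle.trans hρ.2⟩⟩,
      fun _ hτ => hτ.2⟩, hσ⟩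

theorem isSubcomplex_restr (s : Set (Set (Sph d))) (X : Set (Sph d)) :
    IsSubcomplex s (restr s X) := by
  rw [restr_eq]
  exact ⟨fun _ hσ => hσ.1, fun _ hσ _ hτ hle => ⟨hσ, hle.trans hτ.2⟩⟩

theorem dualRestr_image (hN : N ⊆ s) (M : Set (Sph d)) :
    dualRestr s (dualFace s '' N) M = dualFace s '' {σ ∈ N | (σ ∩ M).Nonempty} := by
  apply Set.Subset.antisymm
  · refine Set.sInter_subset_of_mem ⟨⟨Set.image_mono fun σ hσ => hσ.1, ?_⟩, ?_⟩
    · rintro _ ⟨σ, hσ, rfl⟩ _ ⟨τ, ⟨hτ, hτM⟩, rfl⟩ hle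
      have hτσ : τ ⊆ σ := (dualFace_le_dualFace_iff (hN hτ) (hN hσ)).1 hle
      exact ⟨σ, ⟨hσ, hτM.mono (Set.inter_subset_inter_left M hτσ)⟩, rfl⟩
    · intro σ hσ hσM hσN
      exact ⟨σ, ⟨(dualFace_injOn.mem_image_iff hN hσ).1 hσN, hσM⟩, rfl⟩
  · rintro _ ⟨σ, ⟨hσ, hσM⟩, rfl⟩ D ⟨-, hD⟩
    exact hD σ (hN hσ) hσM ⟨σ, hσ, rfl⟩

theorem dualRestr_dualComplex_compl (s : Set (Set (Sph d))) (X : Set (Sph d)) :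
    dualRestr s (dualComplex s) Xᶜ = dualFace s '' (s ∩ (restr s X)ᶜ) := by
  rw [dualComplex, dualRestr_image subset_rfl, restr_eq]
  congr 1
  ext σ
  refine and_congr_right fun hσ => ?_
  rw [Set.inter_compl_nonempty_iff]
  exact ⟨fun h h' => h h'.2, fun h h' => h ⟨hσ, h'⟩⟩

end Restriction

section Flats

variable {R V : Type*} [Ring R] [AddCommGroup V] [Module R V]
variable {E : Set (Submodule R V)} {L : Submodule R V} {u v w : V}

/-- The subspaces in `E` that contain the vector `v`. -/
def through (E : Set (Submodule R V)) (v : V) : Set (Submodule R V) :=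
  {L ∈ E | v ∈ L}

/-- The flat of `v`: the smallest intersection of subspaces in `E` that contains `v`. -/
def flat (E : Set (Submodule R V)) (v : V) : Submodule R V :=
  sInf (through E v)

theorem mem_flat_self (E : Set (Submodule R V)) (v : V) : v ∈ flat E v :=
  Submodule.mem_sInf.2 fun _ hL => hL.2

theorem flat_le (hL : L ∈ E) (hv : v ∈ L) : flat E v ≤ L :=
  sInf_le ⟨hL, hv⟩

theorem through_subset_through_iff : through E v ⊆ through E u ↔ u ∈ flat E v := by
  rw [flat, Submodule.mem_sInf]
  exact ⟨fun h L hL => (h hL).2, fun h L hL => ⟨hL.1, h L hL⟩⟩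

theorem flat_le_flat (hu : u ∈ flat E v) : flat E u ≤ flat E v :=
  sInf_le_sInf (through_subset_through_iff.2 hu)

/-- If `flat S w` is as small as possible for `w ∉ sInf S`, then it meets every `L ∈ S` that avoids
`w` in `sInf S`; by modularity, a cover of such an `L` through `w` makes it cover `sInf S`. -/
theorem exists_covBy_flat [IsArtinian R V] [IsNoetherian R V] {S : Set (Submodule R V)}
    (hS : ∀ L ∈ S, L ≠ ⊤ → ∃ H ∈ insert ⊤ S, L ⋖ H) (htop : sInf S ≠ ⊤) :
    ∃ w, sInf S ⋖ flat S w := by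
  obtain ⟨w, hw, hmin⟩ := exists_minimalFor_of_wellFoundedLT (· ∉ sInf S) (flat S)
    (SetLike.exists_not_mem_of_ne_top _ htop rfl)
  have hinf : ∀ L ∈ S, w ∉ L → L ⊓ flat S w = sInf S := by
    intro L hL hwL
    refine le_antisymm (fun u hu => ?_) (le_inf (sInf_le hL) (sInf_le_sInf fun _ h => h.1))
    by_contra huS
    exact hwL (flat_le hL hu.1 (hmin huS (flat_le_flat hu.2) (mem_flat_self S w)))
  obtain ⟨L, ⟨hL, hwL⟩, hmax⟩ :=
    exists_maximalFor_of_wellFoundedGT (fun L => L ∈ S ∧ w ∉ L) id <| by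
      simpa [Submodule.mem_sInf] using hw
  obtain ⟨H, hH, hLH⟩ := hS L hL (by rintro rfl; simp at hwL)
  have hwH : flat S w ≤ H := by
    rcases hH with rfl | hH
    · exact le_top
    · refine flat_le hH ?_
      by_contra hwH
      exact hLH.lt.not_ge (hmax ⟨hH, hwH⟩ hLH.le)
  have hsup : L ⊔ flat S w = H :=
    (hLH.eq_or_eq le_sup_left (sup_le hLH.le hwH)).resolve_left fun h =>
      hwL (sup_eq_left.1 h (mem_flat_self S w))
  refine ⟨w, ?_⟩
  rw [← hinf L hL hwL]
  exact inf_covBy_of_covBy_sup_left (hsup ▸ hLH)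

end Flats

section Finrank

variable {K V : Type*} [DivisionRing K] [AddCommGroup V] [Module K V] [FiniteDimensional K V]
  {U W : Submodule K V}

theorem finrank_eq_add_one_of_covBy (h : U ⋖ W) :
    Module.finrank K W = Module.finrank K U + 1 := by
  obtain ⟨w, hwW, hwU⟩ := SetLike.exists_of_lt h.lt
  have hsup : U ⊔ Submodule.span K {w} = W :=
    (h.eq_or_eq le_sup_left (sup_le h.le (by simpa using hwW))).resolve_left fun heq =>
      hwU (heq ▸ Submodule.mem_sup_right (Submodule.mem_span_singleton_self w))
  have hle := Submodule.finrank_add_le_finrank_add_finrank U (Submodule.span K {w})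
  rw [hsup] at hle
  have hspan : Module.finrank K (Submodule.span K {w}) = 1 :=
    finrank_span_singleton (ne_of_mem_of_not_mem U.zero_mem hwU).symm
  have hlt := Submodule.finrank_lt_finrank_of_lt h.lt
  omega

theorem covBy_of_lt_of_finrank_le (h : U < W)
    (hrank : Module.finrank K W ≤ Module.finrank K U + 1) : U ⋖ W := by
  refine ⟨h, fun X hUX hXW => ?_⟩
  have h₁ := Submodule.finrank_lt_finrank_of_lt hUX
  have h₂ := Submodule.finrank_lt_finrank_of_lt hXW
  omega

end Finrank

section Strata

open Filter Metric NormedSpace Topology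

variable {F : Type*} [NormedAddCommGroup F] [NormedSpace ℝ F] {E S : Set (Submodule ℝ F)}
  {u v : F} {x y : sphere (0 : F) 1}

/-- The stratum of the point `x`: the set of points that can be joined to `x` by a curve along which
the set of subspaces in `E` through the running point is constant. -/
def stratum (E : Set (Submodule ℝ F)) (x : sphere (0 : F) 1) : Set (sphere (0 : F) 1) :=
  pathComponentIn {y | through E (y : F) = through E (x : F)} x

/-- The cone over the strata cut out by `S`. Curves are constructed in it and then projected to the
sphere. -/
def openCone (E S : Set (Submodule ℝ F)) : Set F :=
  {v | v ≠ 0 ∧ through E v = S}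

theorem mem_stratum_self (E : Set (Submodule ℝ F)) (x : sphere (0 : F) 1) : x ∈ stratum E x :=
  mem_pathComponentIn_self rfl

theorem through_eq_of_mem_stratum (hy : y ∈ stratum E x) :
    through E (y : F) = through E (x : F) := by
  simpa using pathComponentIn_subset hy

theorem stratum_eq_of_mem (hy : y ∈ stratum E x) : stratum E y = stratum E x := by
  rw [stratum, through_eq_of_mem_stratum hy]
  exact pathComponentIn_congr hy

theorem tendsto_add_smul_nhdsGT (u w : F) :
    Tendsto (fun t : ℝ => u + t • w) (𝓝[>] 0) (𝓝 u) := by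
  have hcont : Continuous fun t : ℝ => u + t • w := by fun_prop
  have htendsto := hcont.tendsto 0
  rw [zero_smul, add_zero] at htendsto
  exact htendsto.mono_left nhdsWithin_le_nhds

theorem through_smul {c : ℝ} (hc : c ≠ 0) (v : F) : through E (c • v) = through E v := by
  ext L
  exact and_congr_right fun _ => L.smul_mem_iff hc

section RadialProjection

variable [Nontrivial F]

open Classical in
/-- The radial projection onto the unit sphere. Its value at `0` is an arbitrary point. -/
noncomputable def radialProjection (v : F) : sphere (0 : F) 1 :=
  if h : v = 0 then Classical.choice (sphere_nonempty.2 zero_le_one).to_subtype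
  else ⟨normalize v, by simp [h]⟩

theorem coe_radialProjection (hv : v ≠ 0) : (radialProjection v : F) = normalize v := by
  simp [radialProjection, hv]

theorem norm_smul_radialProjection (v : F) : ‖v‖ • (radialProjection v : F) = v := by
  rcases eq_or_ne v 0 with rfl | hv
  · simp
  · rw [coe_radialProjection hv, norm_smul_normalize]

theorem radialProjection_coe (x : sphere (0 : F) 1) : radialProjection (x : F) = x := by
  apply Subtype.ext
  rw [coe_radialProjection (ne_zero_of_mem_unit_sphere x),
    normalize_eq_self_of_norm_eq_one (norm_eq_of_mem_sphere x)]

theorem continuousAt_radialProjection (hv : v ≠ 0) : ContinuousAt radialProjection v := by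
  rw [IsInducing.subtypeVal.continuousAt_iff]
  have hnormalize : ContinuousAt (fun u : F => ‖u‖⁻¹ • u) v := by fun_prop (disch := simpa)
  refine hnormalize.congr ?_
  filter_upwards [isOpen_ne.mem_nhds hv] with u hu
  exact (coe_radialProjection hu).symm

theorem through_radialProjection (hv : v ≠ 0) :
    through E (radialProjection v : F) = through E v := by
  conv_rhs => rw [← norm_smul_radialProjection v, through_smul (norm_ne_zero_iff.2 hv)]

theorem radialProjection_mem_stratum (h : JoinedIn (openCone E S) u v) :
    radialProjection v ∈ stratum E (radialProjection u) := by
  have hcont : ContinuousOn radialProjection (openCone E S) := fun w hw =>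
    (continuousAt_radialProjection hw.1).continuousWithinAt
  refine (h.map_continuousOn hcont).mono ?_
  rintro _ ⟨w, hw, rfl⟩
  have hu := h.source_mem
  change through E _ = through E _
  rw [through_radialProjection hw.1, through_radialProjection hu.1, hw.2, hu.2]

theorem tendsto_radialProjection_add_smul (x : sphere (0 : F) 1) (w : F) :
    Tendsto (fun t : ℝ => radialProjection ((x : F) + t • w)) (𝓝[>] 0) (𝓝 x) := by
  have hproj := (continuousAt_radialProjection (ne_zero_of_mem_unit_sphere x)).tendsto
  rw [radialProjection_coe] at hproj
  exact hproj.comp (tendsto_add_smul_nhdsGT (x : F) w)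

end RadialProjection

variable [FiniteDimensional ℝ F]

theorem eventually_ne_zero_and_through_subset (hE : E.Finite) (hv : v ≠ 0) :
    ∀ᶠ u in 𝓝 v, u ≠ 0 ∧ through E u ⊆ through E v := by
  have havoid : ∀ L ∈ E, ∀ᶠ u in 𝓝 v, u ∈ L → v ∈ L := by
    intro L _
    by_cases hvL : v ∈ L
    · exact .of_forall fun _ _ => hvL
    · filter_upwards [L.closed_of_finiteDimensional.isOpen_compl.mem_nhds hvL] with u hu h
      exact (hu h).elim
  filter_upwards [isOpen_ne.mem_nhds hv, (eventually_all_finite hE).2 havoid] with u hu h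
  exact ⟨hu, fun L hL => ⟨hL.1, h L hL.1 hL.2⟩⟩

theorem eventually_joinedIn_openCone (hE : E.Finite) (hv : v ≠ 0) :
    ∀ᶠ u in 𝓝[flat E v] v, JoinedIn (openCone E (through E v)) v u := by
  obtain ⟨ε, hε, hball⟩ :=
    Metric.eventually_nhds_iff_ball.1 (eventually_ne_zero_and_through_subset hE hv)
  filter_upwards [inter_mem_nhdsWithin _ (ball_mem_nhds v hε)] with u hu
  have hconvex : Convex ℝ ((flat E v : Set F) ∩ ball v ε) :=
    (flat E v).convex.inter (convex_ball v ε)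
  refine JoinedIn.of_segment_subset fun w hw => ?_
  obtain ⟨hwflat, hwball⟩ :=
    hconvex.segment_subset ⟨mem_flat_self E v, mem_ball_self hε⟩ hu hw
  obtain ⟨hw₀, hwv⟩ := hball w hwball
  exact ⟨hw₀, hwv.antisymm (through_subset_through_iff.2 hwflat)⟩

theorem eventually_add_smul_mem_openCone (hE : E.Finite) {K : Set F} (hK : IsCompact K)
    (hKS : K ⊆ openCone E S) (w : F) :
    ∀ᶠ t : ℝ in 𝓝[>] 0, ∀ u ∈ K, u + t • w ∈ openCone E (through S w) := by
  have hnear : ∀ᶠ t : ℝ in 𝓝 0, ∀ u ∈ K, u + t • w ≠ 0 ∧ through E (u + t • w) ⊆ S := by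
    refine hK.eventually_forall_of_forall_eventually fun u hu => ?_
    obtain ⟨hu₀, rfl⟩ := hKS hu
    have hcont : Continuous fun z : ℝ × F => z.2 + z.1 • w := by fun_prop
    have htendsto := hcont.tendsto (0, u)
    rw [zero_smul, add_zero] at htendsto
    exact htendsto.eventually (eventually_ne_zero_and_through_subset hE hu₀)
  filter_upwards [hnear.filter_mono nhdsWithin_le_nhds, self_mem_nhdsWithin] with t ht ht₀ u hu
  obtain ⟨hne, hsub⟩ := ht u hu
  obtain ⟨-, rfl⟩ := hKS hu
  have hmem (L) (hL : L ∈ through E u) : u + t • w ∈ L ↔ w ∈ L := by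
    rw [L.add_mem_iff_right hL.2, L.smul_mem_iff ht₀.ne']
  refine ⟨hne, Set.Subset.antisymm (fun L hL => ?_) fun L hL => ?_⟩
  · exact ⟨hsub hL, (hmem L (hsub hL)).1 hL.2⟩
  · exact ⟨hL.1.1, (hmem L hL.1).2 hL.2⟩

section StratumClosure

theorem closure_stratum_subset_flat (E : Set (Submodule ℝ F)) (x : sphere (0 : F) 1) :
    closure (stratum E x) ⊆ {y | (y : F) ∈ flat E (x : F)} := by
  refine closure_minimal (fun y hy => ?_)
    ((flat E (x : F)).closed_of_finiteDimensional.preimage continuous_subtype_val)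
  change (y : F) ∈ flat E (x : F)
  rw [flat, ← through_eq_of_mem_stratum hy]
  exact mem_flat_self E (y : F)

variable [Nontrivial F]

theorem eventually_radialProjection_mem_stratum (hE : E.Finite) (x : sphere (0 : F) 1) :
    ∀ᶠ v in 𝓝[flat E (x : F)] (x : F), radialProjection v ∈ stratum E x := by
  filter_upwards [eventually_joinedIn_openCone hE (ne_zero_of_mem_unit_sphere x)] with v hv
  simpa only [radialProjection_coe] using radialProjection_mem_stratum hv

theorem span_closure_stratum (hE : E.Finite) (x : sphere (0 : F) 1) :
    Submodule.span ℝ ((fun y : sphere (0 : F) 1 => (y : F)) '' closure (stratum E x)) =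
      flat E (x : F) := by
  apply le_antisymm
  · rw [Submodule.span_le]
    rintro _ ⟨y, hy, rfl⟩
    exact closure_stratum_subset_flat E x hy
  · intro v hv
    set W := Submodule.span ℝ ((fun y : sphere (0 : F) 1 => (y : F)) '' closure (stratum E x))
    have hstratum (y) (hy : y ∈ stratum E x) : (y : F) ∈ W :=
      Submodule.subset_span ⟨y, subset_closure hy, rfl⟩
    have hline : Tendsto (fun t : ℝ => (x : F) + t • v) (𝓝[>] 0) (𝓝[flat E (x : F)] (x : F)) := by
      refine tendsto_nhdsWithin_iff.2 ⟨tendsto_add_smul_nhdsGT (x : F) v, .of_forall fun t => ?_⟩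
      exact add_mem (mem_flat_self E (x : F)) ((flat E (x : F)).smul_mem t hv)
    obtain ⟨t, ht, ht₀⟩ :=
      ((hline.eventually (eventually_radialProjection_mem_stratum hE x)).and
        self_mem_nhdsWithin).exists
    have hmem : (x : F) + t • v ∈ W := by
      rw [← norm_smul_radialProjection ((x : F) + t • v)]
      exact W.smul_mem _ (hstratum _ ht)
    exact (W.smul_mem_iff (ne_of_gt ht₀)).1
      ((W.add_mem_iff_right (hstratum x (mem_stratum_self E x))).1 hmem)

theorem stratum_eq_of_mem_closure (hE : E.Finite) (hxy : through E (x : F) = through E (y : F))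
    (hx : x ∈ closure (stratum E y)) : stratum E x = stratum E y := by
  have hval : Tendsto (fun z : sphere (0 : F) 1 => (z : F)) (𝓝 x) (𝓝 (x : F)) :=
    continuous_subtype_val.tendsto x
  have hnear := hval.eventually
    (eventually_nhdsWithin_iff.1 (eventually_radialProjection_mem_stratum hE x))
  obtain ⟨z, hzy, hzx⟩ := ((mem_closure_iff_frequently.1 hx).and_eventually hnear).exists
  rw [radialProjection_coe] at hzx
  rw [← stratum_eq_of_mem hzy]
  refine (stratum_eq_of_mem (hzx ?_)).symm
  rw [flat, hxy, ← through_eq_of_mem_stratum hzy]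
  exact mem_flat_self E (z : F)

/-- Moving a curve in the stratum of `x` a little in the direction `w` gives a curve in the stratum
of `z`. -/
theorem exists_stratum_subset_closure_stratum (hE : E.Finite) (x : sphere (0 : F) 1) (w : F) :
    ∃ z : sphere (0 : F) 1, through E (z : F) = through (through E (x : F)) w ∧
      stratum E x ⊆ closure (stratum E z) := by
  set S := through E (x : F)
  have hcone (y : sphere (0 : F) 1) (hy : through E (y : F) = S) : (y : F) ∈ openCone E S :=
    ⟨ne_zero_of_mem_unit_sphere y, hy⟩
  obtain ⟨δ, hδ, hray⟩ := mem_nhdsGT_iff_exists_Ioo_subset.1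
    (eventually_add_smul_mem_openCone hE (isCompact_singleton (x := (x : F)))
      (Set.singleton_subset_iff.2 (hcone x rfl)) w)
  have hpath : IsPathConnected ((fun t : ℝ => (x : F) + t • w) '' Set.Ioo 0 δ) :=
    ((convex_Ioo 0 δ).isPathConnected (Set.nonempty_Ioo.2 hδ)).image (by fun_prop)
  have hsub : (fun t : ℝ => (x : F) + t • w) '' Set.Ioo 0 δ ⊆ openCone E (through S w) := by
    rintro _ ⟨t, ht, rfl⟩
    exact hray ht _ rfl
  obtain ⟨z₀, hz₀⟩ := hpath.nonempty
  refine ⟨radialProjection z₀, ?_, fun y hy => ?_⟩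
  · rw [through_radialProjection (hsub hz₀).1, (hsub hz₀).2]
  obtain ⟨γ, hγ⟩ := hy
  have hγK : Set.range (fun t => (γ t : F)) ⊆ openCone E S := by
    rintro _ ⟨t, rfl⟩
    exact hcone _ (hγ t)
  have htranslate := eventually_add_smul_mem_openCone hE
    (isCompact_range (continuous_subtype_val.comp γ.continuous)) hγK w
  refine mem_closure_of_tendsto (tendsto_radialProjection_add_smul y w) ?_
  filter_upwards [htranslate, Ioo_mem_nhdsGT hδ] with t ht htδ
  refine radialProjection_mem_stratum
    (((hpath.joinedIn _ hz₀ _ ⟨t, htδ, rfl⟩).mono hsub).trans ?_)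
  exact ⟨(γ.map continuous_subtype_val).map (f := (· + t • w)) (by fun_prop),
    fun s => ht _ ⟨s, rfl⟩⟩

end StratumClosure

end Strata

section Stratification

variable {d : ℕ} {A E S : Set (LinSub d)} {σ : Set (Sph d)}

theorem locus_through (E : Set (LinSub d)) (x : Sph d) :
    locus E (through E x) = {y : Sph d | through E y = through E x} := by
  ext y
  constructor
  · rintro ⟨hyx, hy⟩
    refine Set.Subset.antisymm (fun L hL => ?_) fun L hL => ⟨hL.1, hyx L hL⟩
    by_contra hLx
    exact hy L ⟨hL.1, hLx⟩ hL.2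
  · intro h
    change _ = _ at h
    rw [← h]
    exact ⟨fun L hL => hL.2, fun L hL hyL => hL.2 ⟨hL.1, hyL⟩⟩

theorem eq_through_of_mem_locus (hS : S ⊆ E) {x : Sph d} (hx : x ∈ locus E S) :
    S = through E x := by
  refine Set.Subset.antisymm (fun L hL => ⟨hS hL, hx.1 L hL⟩) fun L hL => ?_
  by_contra hLS
  exact hx.2 L ⟨hL.1, hLS⟩ hL.2

theorem mem_stratFaces_iff : σ ∈ stratFaces E ↔ ∃ x : Sph d, closure (stratum E x) = σ := by
  constructor
  · rintro ⟨_, ⟨hne, S, hS, x, rfl⟩, rfl⟩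
    have hx := pathComponentIn_nonempty_iff.1 hne
    refine ⟨x, ?_⟩
    rw [eq_through_of_mem_locus hS hx, locus_through, stratum]
  · rintro ⟨x, rfl⟩
    refine ⟨stratum E x, ⟨⟨x, mem_stratum_self E x⟩, through E x, fun _ hL => hL.1, x, ?_⟩, rfl⟩
    rw [locus_through, stratum]

theorem sphDim_closure_stratum_add_one (hE : E.Finite) (x : Sph d) :
    sphDim (closure (stratum E x)) + 1 =
      Module.finrank ℝ (flat E x) := by
  rw [sphDim, span_closure_stratum hE]
  refine Nat.sub_add_cancel (Submodule.one_le_finrank_iff.2 ?_)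
  exact (Submodule.ne_bot_iff _).2 ⟨x, mem_flat_self E _, ne_zero_of_mem_unit_sphere x⟩

theorem sphDim_le (hE : E.Finite) (hσ : σ ∈ stratFaces E) : sphDim σ ≤ d := by
  obtain ⟨x, rfl⟩ := mem_stratFaces_iff.1 hσ
  have hle := Submodule.finrank_le (flat E x)
  rw [← sphDim_closure_stratum_add_one hE, finrank_euclideanSpace_fin] at hle
  omega

theorem strictMonoOn_sphDim (hE : E.Finite) : StrictMonoOn sphDim (stratFaces E) := by
  intro σ hσ τ hτ hlt
  obtain ⟨x, rfl⟩ := mem_stratFaces_iff.1 hσ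
  obtain ⟨y, rfl⟩ := mem_stratFaces_iff.1 hτ
  have hxy : x ∈ closure (stratum E y) := hlt.le (subset_closure (mem_stratum_self E x))
  have hflat := flat_le_flat (closure_stratum_subset_flat E y hxy)
  have hne : flat E x ≠ flat E y := by
    intro heq
    have hthrough : through E x =
        through E y :=
      Set.Subset.antisymm (through_subset_through_iff.2 (heq ▸ mem_flat_self E _))
        (through_subset_through_iff.2 (heq ▸ mem_flat_self E _))
    exact hlt.ne (congrArg closure (stratum_eq_of_mem_closure hE hthrough hxy))
  have hrank := Submodule.finrank_lt_finrank_of_lt (hflat.lt_of_ne hne)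
  rw [← sphDim_closure_stratum_add_one hE, ← sphDim_closure_stratum_add_one hE] at hrank
  omega

theorem exists_mem_stratFaces_sphDim_eq_add_one (hE : E.Finite)
    (hcover : ∀ L ∈ E, L ≠ ⊤ → ∃ H ∈ insert ⊤ E, L ⋖ H) (hσ : σ ∈ stratFaces E)
    (hd : sphDim σ < d) : ∃ τ ∈ stratFaces E, σ < τ ∧ sphDim τ = sphDim σ + 1 := by
  obtain ⟨x, rfl⟩ := mem_stratFaces_iff.1 hσ
  have hdim := sphDim_closure_stratum_add_one hE x
  have htop : flat E x ≠ ⊤ := by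
    intro h
    rw [h, finrank_top, finrank_euclideanSpace_fin] at hdim
    omega
  obtain ⟨w, hw⟩ := exists_covBy_flat (S := through E x)
    (fun L hL hLtop => by
      obtain ⟨H, hH, hLH⟩ := hcover L hL.1 hLtop
      exact ⟨H, hH.imp_right fun hHE => ⟨hHE, hLH.le hL.2⟩, hLH⟩) htop
  obtain ⟨z, hz, hxz⟩ := exists_stratum_subset_closure_stratum hE x w
  have hzdim : sphDim (closure (stratum E z)) = sphDim (closure (stratum E x)) + 1 := by
    have hrank := finrank_eq_add_one_of_covBy hw
    rw [flat, ← hz] at hrank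
    have hdim' := sphDim_closure_stratum_add_one hE z
    rw [flat] at hdim hdim'
    omega
  refine ⟨_, mem_stratFaces_iff.2 ⟨z, rfl⟩, ?_, hzdim⟩
  refine (closure_minimal hxz isClosed_closure).lt_of_ne fun h => ?_
  rw [← h] at hzdim
  omega

theorem blockDim_dualFace_add_sphDim (hE : E.Finite)
    (hcover : ∀ L ∈ E, L ≠ ⊤ → ∃ H ∈ insert ⊤ E, L ⋖ H) (hσ : σ ∈ stratFaces E) :
    blockDim (dualFace (stratFaces E) σ) + sphDim σ = d :=
  blockDim_dualFace_add (strictMonoOn_sphDim hE) (fun _ => sphDim_le hE)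
    (fun _ => exists_mem_stratFaces_sphDim_eq_add_one hE hcover) hσ

theorem IsHyperplane.covBy_top {H : LinSub d} (hH : IsHyperplane H) : H ⋖ ⊤ := by
  have hrank : Module.finrank ℝ (⊤ : LinSub d) = d + 1 := by
    rw [finrank_top, finrank_euclideanSpace_fin]
  refine covBy_of_lt_of_finrank_le (lt_top_iff_ne_top.2 ?_) (hrank.trans hH.symm).le
  rintro rfl
  rw [IsHyperplane, hrank] at hH
  omega

theorem IsExtension.exists_covBy (hE : IsExtension A E)
    (hA : ∀ L ∈ A, Module.finrank ℝ L + 2 = d + 1) :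
    ∀ L ∈ E, ∃ H ∈ insert ⊤ E, L ⋖ H := by
  intro L hL
  rcases hE.mem L hL with hLH | hLA
  · exact ⟨⊤, Set.mem_insert ⊤ E, hLH.covBy_top⟩
  · obtain ⟨H, hHE, hH, hLH⟩ := hE.exists_hyperplane L hLA
    have hLrank := hA L hLA
    rw [IsHyperplane] at hH
    refine ⟨H, Set.mem_insert_of_mem ⊤ hHE, covBy_of_lt_of_finrank_le (hLH.lt_of_ne ?_) (by omega)⟩
    rintro rfl
    omega

end Stratification

end MorseDuality

theorem mainTheorem6_general {d : ℕ} {E : Set (LinSub d)} (hE : E.Finite)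
    (hcover : ∀ L ∈ E, L ≠ ⊤ → ∃ H ∈ insert ⊤ E, L ⋖ H) (X : Set (Sph d))
    {Φ : Set (Set (Sph d) × Set (Sph d))}
    (hΦ : IsDiscreteVectorField (stratFaces E) sphDim Φ) :
    (∀ i : ℕ, Nonempty
      (↥(criticalFacesOfDim (dualRestr (stratFaces E) (dualComplex (stratFaces E)) Xᶜ) blockDim
          (restrictMatching (dualMatching (stratFaces E) Φ)
            (dualRestr (stratFaces E) (dualComplex (stratFaces E)) Xᶜ)) i) ≃
        ↥({σ | σ ∈ criticalFaces (stratFaces E) Φ ∧ sphDim σ + i = d ∧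
              σ ∉ restr (stratFaces E) X} ∪
          {σ | σ ∈ outwardlyMatched (restr (stratFaces E) X) Φ ∧ sphDim σ + i + 1 = d}))) ∧
    (∀ M : Set (Sph d),
      (∀ σ ∈ stratFaces E, σ ∉ criticalFaces (stratFaces E) Φ → (σ ∩ M).Nonempty) →
      ∀ i : ℕ, Nonempty
        (↥(criticalFacesOfDim
            (dualRestr (stratFaces E)
              (dualRestr (stratFaces E) (dualComplex (stratFaces E)) Xᶜ) M) blockDim
            (restrictMatching (dualMatching (stratFaces E) Φ)
              (dualRestr (stratFaces E)
                (dualRestr (stratFaces E) (dualComplex (stratFaces E)) Xᶜ) M)) i) ≃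
          ↥({σ | σ ∈ criticalFaces (stratFaces E) Φ ∧ sphDim σ + i = d ∧
                σ ∉ restr (stratFaces E) X ∧ (σ ∩ M).Nonempty} ∪
            {σ | σ ∈ outwardlyMatched (restr (stratFaces E) X) Φ ∧ sphDim σ + i + 1 = d}))) := by
  set s := stratFaces E
  have hdim : ∀ σ ∈ s, blockDim (dualFace s σ) + sphDim σ = d :=
    fun _ => blockDim_dualFace_add_sphDim hE hcover
  have hR := isSubcomplex_restr s X
  have hup : ∀ σ ∈ s, ∀ τ ∈ s, σ ≤ τ → σ ∉ restr s X → τ ∉ restr s X :=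
    fun σ hσ τ _ hστ hσR hτR => hσR (hR.2 σ hσ τ hτR hστ)
  rw [dualRestr_dualComplex_compl]
  refine ⟨nonempty_criticalFacesOfDim_dualMatching_equiv (U := (restr s X)ᶜ) hdim hΦ hR
    disjoint_compl_left hup fun σ _ _ hσR => hσR, fun M hM => ?_⟩
  rw [dualRestr_image Set.inter_subset_left]
  have hinter : {σ ∈ s ∩ (restr s X)ᶜ | (σ ∩ M).Nonempty} =
      s ∩ {σ | σ ∉ restr s X ∧ (σ ∩ M).Nonempty} :=
    Set.inter_assoc s (restr s X)ᶜ {σ | (σ ∩ M).Nonempty}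
  rw [hinter]
  exact nonempty_criticalFacesOfDim_dualMatching_equiv hdim hΦ hR
    (Set.disjoint_left.2 fun _ hσ => hσ.1)
    (fun σ hσ τ hτ hστ hσU =>
      ⟨hup σ hσ τ hτ hστ hσU.1, hσU.2.mono (Set.inter_subset_inter_left M hστ)⟩)
    fun σ hσ hcrit hσR => ⟨hσR, hM σ hσ hcrit⟩

theorem mainTheorem6 (d : ℕ) (A E : Set (LinSub d))
    (hA : IsCodimTwoArrangement A) (hE : IsExtension A E) (hfine : IsFine E)
    (Φ : Set (Set (Sph d) × Set (Sph d)))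
    (hΦ : IsMorseMatching (stratFaces E) sphDim Φ) :
    (∀ i : ℕ, Nonempty
      (↥(criticalFacesOfDim (complementComplex A (stratFaces E)) blockDim
          (restrictMatching (dualMatching (stratFaces E) Φ)
            (complementComplex A (stratFaces E))) i) ≃
        ↥({σ | σ ∈ criticalFaces (stratFaces E) Φ ∧ sphDim σ + i = d ∧
              σ ∉ restr (stratFaces E) (support A)} ∪
          {σ | σ ∈ outwardlyMatched (restr (stratFaces E) (support A)) Φ ∧
              sphDim σ + i + 1 = d}))) ∧
    (∀ M : Set (Sph d), IsOpen M →
      (∀ σ ∈ stratFaces E, σ ∉ criticalFaces (stratFaces E) Φ → (σ ∩ M).Nonempty) →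
      ∀ i : ℕ, Nonempty
        (↥(criticalFacesOfDim (dualRestr (stratFaces E) (complementComplex A (stratFaces E)) M)
            blockDim
            (restrictMatching (dualMatching (stratFaces E) Φ)
              (dualRestr (stratFaces E) (complementComplex A (stratFaces E)) M)) i) ≃
          ↥({σ | σ ∈ criticalFaces (stratFaces E) Φ ∧ sphDim σ + i = d ∧
                σ ∉ restr (stratFaces E) (support A) ∧ (σ ∩ M).Nonempty} ∪
            {σ | σ ∈ outwardlyMatched (restr (stratFaces E) (support A)) Φ ∧
                sphDim σ + i + 1 = d}))) :=
  have h := mainTheorem6_general hE.finite (fun L hL _ => hE.exists_covBy hA.2 L hL) (support A)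
    hΦ.vectorField
  ⟨h.1, fun M _ => h.2 M⟩
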